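/- Let $E=\{1,\dots,L\}$ be a finite ground set, let $\Theta\subseteq 2^E$ be a non-empty family of feasible sets (solutions) such that every item $e\in E$ lies in some $A\in\Theta$, and let $P$ be a probability distribution on $[0,1]^E$. Put $f(A,w)=\sum_{e\in A}w(e)$, $K=\max_{A\in\Theta}|A|$ and $\bar w=\mathbb E_{w\sim P}[w]$. Assume that $f(\cdot,\bar w)$ has a unique maximizer $A^*$ over $\Theta$; let $\Delta_A=f(A^*,\bar w)-f(A,\bar w)$, $\tilde E=E\setminus A^*$, and, for $e\in\tilde E$, $\Delta_{e,\min}=\min\{\Delta_A: A\in\Theta,\ e\in A,\ \Delta_A>0\}$. Let $w_1,w_2,\dots$ be i.i.d. with law $P$. The algorithm CombUCB1 uses an oracle, a (measurable) map that sends each $v\in\mathbb R^E$ to some element of $\arg\max_{A\in\Theta}f(A,v)$. At each time $t=1,2,\dots$ it chooses $A_t\in\Theta$ and observes $w_t(e)$ for $e\in A_t$, as follows. Initialization: start with $t=1$ and $u(e)=1$ for all $e$. While $u(e)=1$ for some $e$, let $A_t$ be the output of the oracle on $u$, set $\hat w(e)\leftarrow w_t(e)$ and $u(e)\leftarrow 0$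 for all $e\in A_t$, and increase $t$ by one. Let $t_0$ be the value of $t$ at the end of this phase, and set $T(e)\leftarrow 1$ for all $e$. Main phase: at each time $t\ge t_0$, let $U_t(e)=\hat w(e)+\sqrt{1.5\log(t-1)/T(e)}$ for all $e$, let $A_t$ be the output of the oracle on $U_t$, and for all $e\in A_t$ set $\hat w(e)\leftarrow (T(e)\hat w(e)+w_t(e))/(T(e)+1)$ and then $T(e)\leftarrow T(e)+1$. Then for every $n$ the expected cumulative regret $R(n)=\mathbb E\big[\sum_{t=1}^n\big(f(A^*,w_t)-f(A_t,w_t)\big)\big]$ of CombUCB1 is well defined and satisfies $$R(n)\le\sum_{e\in\tilde E}K^{4/3}\,\frac{96}{\Delta_{e,\min}}\log n+\Big(\frac{\pi^2}{3}+1\Big)KL .$$ (For $n=0$, $\log 0$ is read as $0$.) -/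

import Mathlib

open MeasureTheory ProbabilityTheory

noncomputable section

namespace CombSemiBandit

/-- The return `f(A, w)`: the sum of the weights `w e` of the items `e` in `A`. -/
def ret {L : ℕ} (A : Finset (Fin L)) (w : Fin L → ℝ) : ℝ :=
  ∑ e ∈ A, w e

end CombSemiBandit

/-- A stochastic combinatorial semi-bandit `(E, Θ, P)` with ground set `E = Fin L`, a non-empty
family `Θ` of feasible subsets of `E`, and a probability distribution `P` on the cube `[0, 1]^E`
(a Borel probability measure on `ℝ^E` that is carried by the cube). -/
structure CombSemiBandit (L : ℕ) where
  /-- the feasible set -/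
  Θ : Finset (Finset (Fin L))
  nonempty : Θ.Nonempty
  /-- the distribution of the weights -/
  P : Measure (Fin L → ℝ)
  isProb : IsProbabilityMeasure P
  cube : ∀ᵐ w ∂P, ∀ e, w e ∈ Set.Icc (0 : ℝ) 1

namespace CombSemiBandit

/-- The maximum number of chosen items, `K = max_{A ∈ Θ} |A|`. -/
def K {L : ℕ} (B : CombSemiBandit L) : ℕ :=
  B.Θ.sup Finset.card

/-- The expected weights of the items. -/
def meanWeight {L : ℕ} (B : CombSemiBandit L) (e : Fin L) : ℝ :=
  ∫ w, w e ∂B.P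

/-- `Astar` is the unique optimal solution for the expected weights. -/
def IsUniqueOptimal {L : ℕ} (B : CombSemiBandit L) (Astar : Finset (Fin L)) : Prop :=
  Astar ∈ B.Θ ∧ ∀ A ∈ B.Θ, A ≠ Astar → ret A B.meanWeight < ret Astar B.meanWeight

/-- The gap `Δ_A` of a solution `A`. -/
def gap {L : ℕ} (B : CombSemiBandit L) (Astar A : Finset (Fin L)) : ℝ :=
  ret Astar B.meanWeight - ret A B.meanWeight

/-- `Δ_{e,min}`: the minimum gap of the suboptimal solutions that contain item `e`. -/
def minGap {L : ℕ} (B : CombSemiBandit L) (Astar : Finset (Fin L)) (e : Fin L) : ℝ :=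
  sInf (B.gap Astar '' {A | A ∈ B.Θ ∧ e ∈ A ∧ 0 < B.gap Astar A})

/-- For an item outside the unique optimal solution that lies in some feasible solution, the
infimum in `minGap` is a minimum over a non-empty set. -/
theorem isLeast_minGap {L : ℕ} (B : CombSemiBandit L) (Astar : Finset (Fin L))
    (hopt : B.IsUniqueOptimal Astar) (e : Fin L) (he : e ∉ Astar)
    (hcover : ∃ A ∈ B.Θ, e ∈ A) :
    IsLeast (B.gap Astar '' {A | A ∈ B.Θ ∧ e ∈ A ∧ 0 < B.gap Astar A}) (B.minGap Astar e) := by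
  obtain ⟨A, hA, heA⟩ := hcover
  have hfin : (B.gap Astar '' {A | A ∈ B.Θ ∧ e ∈ A ∧ 0 < B.gap Astar A}).Finite :=
    (Set.toFinite _).image _
  have hne : (B.gap Astar '' {A | A ∈ B.Θ ∧ e ∈ A ∧ 0 < B.gap Astar A}).Nonempty :=
    ⟨_, A, ⟨hA, heA, sub_pos.2 (hopt.2 A hA fun h => he (h ▸ heA))⟩, rfl⟩
  exact ⟨hne.csInf_mem hfin, fun x hx => csInf_le hfin.bddBelow hx⟩

/-- An offline optimization oracle: a map that sends every weight vector `w` to a feasible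
solution that maximizes `f(·, w)`, with ties broken by a measurable rule. -/
structure IsOracle {L : ℕ} (B : CombSemiBandit L)
    (oracle : (Fin L → ℝ) → Finset (Fin L)) : Prop where
  mem : ∀ w, oracle w ∈ B.Θ
  le : ∀ w, ∀ A ∈ B.Θ, ret A w ≤ ret (oracle w) w
  meas : ∀ A, MeasurableSet {w | oracle w = A}

/-- The internal state of CombUCB1. -/
structure State (L : ℕ) where
  /-- the auxiliary weights of the initialization phase, with entries in `{0, 1}` -/
  u : Fin L → ℝ
  /-- the observation counters -/
  T : Fin L → ℕ
  /-- the estimates of the expected weights -/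
  what : Fin L → ℝ

/-- The state before the first step. -/
def State.init (L : ℕ) : State L where
  u := fun _ => 1
  T := fun _ => 0
  what := fun _ => 0

/-- The radius `c_{t,s} = √(1.5 log t / s)` of the confidence interval. -/
def radius (t s : ℕ) : ℝ :=
  Real.sqrt (1.5 * Real.log t / s)

/-- The upper confidence bounds `U_t`, computed from the state `S` after `t - 1` steps. -/
def State.ucb {L : ℕ} (S : State L) (t : ℕ) (e : Fin L) : ℝ :=
  S.what e + radius (t - 1) (S.T e)

/-- The solution that CombUCB1 chooses at time `t ≥ 1` in the state `S`: as long as some item is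
unobserved, it maximizes the auxiliary weights `u`; afterwards it maximizes the upper confidence
bounds. -/
def State.choose {L : ℕ} (oracle : (Fin L → ℝ) → Finset (Fin L)) (t : ℕ) (S : State L) :
    Finset (Fin L) :=
  if ∃ e, S.u e = 1 then oracle S.u else oracle (S.ucb t)

/-- The update of the state after solution `A` was chosen and the weights `w e`, `e ∈ A`, were
observed. In the initialization phase an observed weight replaces the estimate and the counter is
set to one (so all counters are equal to one when the phase ends); afterwards the counters of the
chosen items increase by one and their estimates become the new averages. -/
def State.update {L : ℕ} (S : State L) (A : Finset (Fin L)) (w : Fin L → ℝ) : State L :=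
  if ∃ e, S.u e = 1 then
    { u := fun e => if e ∈ A then 0 else S.u e
      T := fun e => if e ∈ A then 1 else S.T e
      what := fun e => if e ∈ A then w e else S.what e }
  else
    { u := S.u
      T := fun e => if e ∈ A then S.T e + 1 else S.T e
      what := fun e =>
        if e ∈ A then (S.T e * S.what e + w e) / ((S.T e + 1 : ℕ) : ℝ) else S.what e }

/-- The state of CombUCB1 after `t` steps on the weights `w 1, w 2, …`. -/
def stateAfter {L : ℕ} (oracle : (Fin L → ℝ) → Finset (Fin L)) (w : ℕ → Fin L → ℝ) :
    ℕ → State L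
  | 0 => State.init L
  | t + 1 =>
    (stateAfter oracle w t).update ((stateAfter oracle w t).choose oracle (t + 1)) (w (t + 1))

/-- The solution `A_t` that CombUCB1 chooses at time `t ≥ 1`. It depends only on the weights at
times `1, …, t - 1`. -/
def action {L : ℕ} (oracle : (Fin L → ℝ) → Finset (Fin L)) (w : ℕ → Fin L → ℝ) (t : ℕ) :
    Finset (Fin L) :=
  (stateAfter oracle w (t - 1)).choose oracle t

/-- The cumulative regret of CombUCB1 in `n` steps on the weights `w 1, …, w n`. -/
def cumRegret {L : ℕ} (Astar : Finset (Fin L)) (oracle : (Fin L → ℝ) → Finset (Fin L))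
    (w : ℕ → Fin L → ℝ) (n : ℕ) : ℝ :=
  ∑ t ∈ Finset.Icc 1 n, (ret Astar (w t) - ret (action oracle w t) (w t))

end CombSemiBandit

end

/-! Because `A_t` depends only on `w_1, …, w_{t-1}`, it is independent of `w_t`, so the expected
regret is the expected sum of the gaps of the chosen solutions (`integral_cumRegret`). Along each
path that sum is split into three kinds of steps (`sum_gap_le`).

Initialization steps: there are at most `L`, each with gap at most `K`. Steps of the main phase at
which some confidence interval fails: again each costs at most `K`. The exponential process
`expState` has mean at most 1, so Markov's inequality and a union bound over the at most `i` values
of the counter give failure probability at most `2 / i ^ 2` per item, and these sum to at most `π ^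
2 / 3`.

Steps at which all intervals hold: optimism gives `Δ ≤ 2 ∑ r_e` over the chosen items outside
`Astar`, where `r_e` is the radius. There are at most `K` such items and each satisfies `Δ_{e,min} ≤
Δ`, so `∑ Δ_{e,min} / K ≤ Δ`. Subtracting this from `2 Δ ≤ 4 ∑ r_e` leaves `Δ ≤ ∑ (4 r_e - Δ_{e,min}
/ K)⁺` (`gap_le_sum_max`). Each summand now depends on one item, and the sum over that item's
observations telescopes under `potential` to at most `a ^ 2 / d`, with `a = 4 √(1.5 log n)` and `d =
Δ_{e,min} / K`, that is, `24 K log n / Δ_{e,min}`.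

This is linear in `K`, hence stronger than the claim with `96 K ^ (4/3)`; no case distinction on how
often items have been observed is needed. -/

namespace CombSemiBandit

variable {L : ℕ}

/-! ### The potential that sums truncated confidence radii -/

/-- The concave potential whose increments dominate the terms `(a / √s - d)⁺`. -/
noncomputable def potential (a d x : ℝ) : ℝ :=
  (a ^ 2 - max (a - d * Real.sqrt x) 0 ^ 2) / d

theorem potential_zero {a d : ℝ} (ha : 0 ≤ a) : potential a d 0 = 0 := by
  simp [potential, ha]

theorem potential_le {a d : ℝ} (hd : 0 < d) (x : ℝ) : potential a d x ≤ a ^ 2 / d := by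
  unfold potential
  gcongr
  nlinarith [sq_nonneg (max (a - d * Real.sqrt x) 0)]

/-- The derivative of the potential is `(a / √x - d)⁺`, which is decreasing where positive, so its
integral over `[s - 1, s]` is at least its value at `s`. The proof does this algebraically with `x =
√s`, `y = √(s - 1)`. -/
theorem le_potential_sub {a d : ℝ} (hd : 0 < d) {s : ℕ} (hs : 1 ≤ s) :
    max (a / Real.sqrt s - d) 0 ≤ potential a d s - potential a d ((s - 1 : ℕ) : ℝ) := by
  have hs' : (1 : ℝ) ≤ s := by exact_mod_cast hs
  unfold potential
  rw [Nat.cast_sub hs, Nat.cast_one]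
  set x := Real.sqrt s with hx
  set y := Real.sqrt ((s : ℝ) - 1) with hy
  have hx2 : x ^ 2 = s := Real.sq_sqrt (by linarith)
  have hy2 : y ^ 2 = s - 1 := Real.sq_sqrt (by linarith)
  have hxy : y ≤ x := Real.sqrt_le_sqrt (by linarith)
  have hy0 : 0 ≤ y := Real.sqrt_nonneg _
  have hx0 : 0 < x := Real.sqrt_pos.2 (by linarith)
  have hdxy : d * y ≤ d * x := mul_le_mul_of_nonneg_left hxy hd.le
  rw [← sub_div, le_div_iff₀ hd]
  rcases le_total a (d * x) with h | h
  · have h1 : a / x - d ≤ 0 := by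
      rw [sub_nonpos, div_le_iff₀ hx0]; exact h
    rw [max_eq_right h1, max_eq_right (by linarith : a - d * x ≤ 0)]
    nlinarith [sq_nonneg (max (a - d * y) 0)]
  · have h1 : 0 ≤ a / x - d := by
      rw [sub_nonneg, le_div_iff₀ hx0]; exact h
    rw [max_eq_left h1, max_eq_left (by linarith : 0 ≤ a - d * x),
      max_eq_left (by linarith : 0 ≤ a - d * y)]
    have ha : 0 ≤ a := le_trans (by positivity) h
    have h2 : a / x ≤ 2 * a * (x - y) := by
      rw [div_le_iff₀ hx0]
      -- `1 = x ^ 2 - y ^ 2 = (x - y) (x + y)`, and `y ≤ x`.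
      have : 1 ≤ 2 * (x - y) * x := by nlinarith
      nlinarith
    have h3 : (a - d * y) ^ 2 - (a - d * x) ^ 2 = (2 * a * (x - y) - d) * d := by
      have : d * d * (x ^ 2 - y ^ 2) = d * d := by rw [hx2, hy2]; ring
      nlinarith
    nlinarith

/-! ### Deterministic facts along one path -/

/-- The initialization phase is not over. -/
def State.Exploring (S : State L) : Prop := ∃ e, S.u e = 1

section Path

variable (oracle : (Fin L → ℝ) → Finset (Fin L)) (w : ℕ → Fin L → ℝ)

theorem stateAfter_succ (i : ℕ) : stateAfter oracle w (i + 1) =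
    (stateAfter oracle w i).update (action oracle w (i + 1)) (w (i + 1)) := rfl

theorem action_of_exploring {i : ℕ} (h : (stateAfter oracle w i).Exploring) :
    action oracle w (i + 1) = oracle (stateAfter oracle w i).u := by
  simp only [action, Nat.add_sub_cancel, State.choose]
  exact if_pos h

theorem action_of_not_exploring {i : ℕ} (h : ¬ (stateAfter oracle w i).Exploring) :
    action oracle w (i + 1) = oracle ((stateAfter oracle w i).ucb (i + 1)) := by
  simp only [action, Nat.add_sub_cancel, State.choose]
  exact if_neg h

theorem update_of_exploring {S : State L} (h : S.Exploring) (A : Finset (Fin L))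
    (v : Fin L → ℝ) : S.update A v =
    { u := fun e => if e ∈ A then 0 else S.u e
      T := fun e => if e ∈ A then 1 else S.T e
      what := fun e => if e ∈ A then v e else S.what e } := if_pos h

theorem update_of_not_exploring {S : State L} (h : ¬ S.Exploring) (A : Finset (Fin L))
    (v : Fin L → ℝ) : S.update A v =
    { u := S.u
      T := fun e => if e ∈ A then S.T e + 1 else S.T e
      what := fun e =>
        if e ∈ A then (S.T e * S.what e + v e) / ((S.T e + 1 : ℕ) : ℝ) else S.what e } :=
  if_neg h

/-- In the initialization phase `u` changes only through the oracle applied to `u` itself, and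
afterwards it is frozen. Hence the phase and its choices are non-random, which the exponential bound
needs. -/
theorem stateAfter_u_eq (w' : ℕ → Fin L → ℝ) (i : ℕ) :
    (stateAfter oracle w i).u = (stateAfter oracle w' i).u := by
  induction i with
  | zero => rfl
  | succ i ih =>
    rw [stateAfter_succ, stateAfter_succ]
    by_cases h : (stateAfter oracle w i).Exploring
    · have h' : (stateAfter oracle w' i).Exploring := by
        unfold State.Exploring at h ⊢; rwa [← ih]
      rw [update_of_exploring h, update_of_exploring h', action_of_exploring oracle w h,
        action_of_exploring oracle w' h', ih]
    · have h' : ¬ (stateAfter oracle w' i).Exploring := by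
        unfold State.Exploring at h ⊢; rwa [← ih]
      rw [update_of_not_exploring h, update_of_not_exploring h']
      exact ih

theorem exploring_iff (w' : ℕ → Fin L → ℝ) (i : ℕ) :
    (stateAfter oracle w i).Exploring ↔ (stateAfter oracle w' i).Exploring := by
  unfold State.Exploring
  rw [stateAfter_u_eq oracle w w']

theorem exploring_zero (e : Fin L) : (stateAfter oracle w 0).Exploring := ⟨e, rfl⟩

/-- Once no entry of `u` equals 1, this invariant makes every counter positive, so no radius of the
main phase is a division by zero. -/
theorem u_eq_one_or (i : ℕ) (e : Fin L) : (stateAfter oracle w i).u e = 1 ∨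
    (stateAfter oracle w i).u e = 0 ∧ 1 ≤ (stateAfter oracle w i).T e := by
  induction i with
  | zero => exact Or.inl rfl
  | succ i ih =>
    rw [stateAfter_succ]
    by_cases h : (stateAfter oracle w i).Exploring
    · rw [update_of_exploring h]
      by_cases he : e ∈ action oracle w (i + 1) <;> simp [he, ih]
    · rw [update_of_not_exploring h]
      by_cases he : e ∈ action oracle w (i + 1)
      · simp only [he, if_true]
        exact ih.imp id fun h => ⟨h.1, by omega⟩
      · simpa [he] using ih

theorem one_le_T {i : ℕ} (h : ¬ (stateAfter oracle w i).Exploring) (e : Fin L) :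
    1 ≤ (stateAfter oracle w i).T e :=
  ((u_eq_one_or oracle w i e).resolve_left fun h1 => h ⟨e, h1⟩).2

theorem T_le (i : ℕ) (e : Fin L) : (stateAfter oracle w i).T e ≤ i := by
  induction i with
  | zero => exact le_rfl
  | succ i ih =>
    rw [stateAfter_succ]
    by_cases h : (stateAfter oracle w i).Exploring
    · rw [update_of_exploring h]
      dsimp only
      split_ifs <;> omega
    · rw [update_of_not_exploring h]
      dsimp only
      split_ifs <;> omega

theorem exploring_of_succ {i : ℕ} (h : (stateAfter oracle w (i + 1)).Exploring) :
    (stateAfter oracle w i).Exploring := by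
  by_contra hn
  rw [stateAfter_succ, update_of_not_exploring hn] at h
  exact hn h

theorem T_le_one {i : ℕ} (h : (stateAfter oracle w i).Exploring) (e : Fin L) :
    (stateAfter oracle w i).T e ≤ 1 := by
  induction i with
  | zero => exact Nat.zero_le _
  | succ i ih =>
    have h' := exploring_of_succ oracle w h
    rw [stateAfter_succ, update_of_exploring h']
    dsimp only
    split_ifs
    · exact le_rfl
    · exact ih h'

-- A main-phase choice made at counter value `s` pays for the potential increment from `s - 1` to
-- `s`. The potential is taken at `T - 1` because the observation from initialization contributes no
-- term; truncated subtraction also covers `T = 0`.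
open Classical in
theorem sum_main_le_potential {a : ℝ} (ha : 0 ≤ a) {d : ℝ} (hd : 0 < d) (e : Fin L) (n : ℕ) :
    ∑ i ∈ Finset.range n, (if ¬ (stateAfter oracle w i).Exploring ∧
        e ∈ action oracle w (i + 1) then
      max (a / Real.sqrt ((stateAfter oracle w i).T e) - d) 0 else 0) ≤
    potential a d (((stateAfter oracle w n).T e - 1 : ℕ) : ℝ) := by
  induction n with
  | zero => simp [stateAfter, State.init, potential_zero ha]
  | succ i ih =>
    rw [Finset.sum_range_succ]
    by_cases h : (stateAfter oracle w i).Exploring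
    · rw [if_neg (fun h' => h'.1 h), add_zero]
      have h0 : (stateAfter oracle w i).T e - 1 = 0 := by
        have := T_le_one oracle w h e
        omega
      rw [h0] at ih
      have h1 : (stateAfter oracle w (i + 1)).T e - 1 = 0 := by
        rw [stateAfter_succ, update_of_exploring h]
        dsimp only
        split_ifs <;> simp [h0]
      rw [h1]
      exact ih
    · rw [stateAfter_succ, update_of_not_exploring h]
      dsimp only
      by_cases he : e ∈ action oracle w (i + 1)
      · rw [if_pos ⟨h, he⟩, if_pos he, Nat.add_sub_cancel]
        have := le_potential_sub (a := a) hd (one_le_T oracle w h e)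
        linarith
      · rw [if_neg (fun h' => he h'.2), if_neg he, add_zero]
        exact ih

variable {oracle} (B : CombSemiBandit L)

-- `∑ u` starts at `L` and stays nonnegative. An unobserved item lies in some feasible set, so the
-- maximizer of `u` has value at least 1, and choosing it lowers `∑ u` by that value.
open Classical in
theorem count_exploring_le (hcover : ∀ e : Fin L, ∃ A ∈ B.Θ, e ∈ A) (horacle : B.IsOracle oracle)
    (n : ℕ) :
    ∑ i ∈ Finset.range n, (if (stateAfter oracle w i).Exploring then (1 : ℝ) else 0) ≤ L := by
  have hu0 : ∀ i e, 0 ≤ (stateAfter oracle w i).u e := fun i e => by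
    rcases u_eq_one_or oracle w i e with h | h
    · rw [h]; exact zero_le_one
    · rw [h.1]
  suffices h : ∑ i ∈ Finset.range n, (if (stateAfter oracle w i).Exploring then (1 : ℝ) else 0) +
      ∑ e, (stateAfter oracle w n).u e ≤ L from
    le_trans (le_add_of_nonneg_right (Finset.sum_nonneg fun e _ => hu0 n e)) h
  induction n with
  | zero => simp [stateAfter, State.init]
  | succ i ih =>
    rw [Finset.sum_range_succ]
    by_cases h : (stateAfter oracle w i).Exploring
    · obtain ⟨e, he⟩ := h
      obtain ⟨A, hA, heA⟩ := hcover e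
      have h1 : 1 ≤ ret (action oracle w (i + 1)) (stateAfter oracle w i).u := by
        rw [action_of_exploring oracle w ⟨e, he⟩]
        refine le_trans ?_ (horacle.le _ A hA)
        rw [← he]
        exact Finset.single_le_sum (fun e _ => hu0 i e) heA
      have h2 : ∑ e, (stateAfter oracle w (i + 1)).u e +
          ret (action oracle w (i + 1)) (stateAfter oracle w i).u =
          ∑ e, (stateAfter oracle w i).u e := by
        rw [stateAfter_succ, update_of_exploring ⟨e, he⟩, ret,
          ← Finset.sum_filter_add_sum_filter_not Finset.univ (· ∈ action oracle w (i + 1))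
            (fun e => (stateAfter oracle w i).u e)]
        dsimp only
        rw [Finset.sum_ite, Finset.sum_const_zero, zero_add, add_comm]
        simp
      rw [if_pos ⟨e, he⟩]
      linarith
    · rw [if_neg h, stateAfter_succ, update_of_not_exploring h, add_zero]
      exact ih

end Path

/-! ### Gaps, optimism and the pathwise regret bound -/

section Gap

variable (B : CombSemiBandit L)

theorem integrable_eval (e : Fin L) : Integrable (fun v : Fin L → ℝ => v e) B.P := by
  have := B.isProb
  refine Integrable.of_mem_Icc 0 1 (measurable_pi_apply e).aemeasurable ?_
  filter_upwards [B.cube] with v hv using hv e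

theorem meanWeight_mem_Icc (e : Fin L) : B.meanWeight e ∈ Set.Icc (0 : ℝ) 1 := by
  have := B.isProb
  constructor
  · refine integral_nonneg_of_ae ?_
    filter_upwards [B.cube] with v hv using (hv e).1
  · refine (integral_mono_ae (B.integrable_eval e) (integrable_const 1) ?_).trans_eq (by simp)
    filter_upwards [B.cube] with v hv using (hv e).2

variable {B} {Astar : Finset (Fin L)}

theorem card_le_K {A : Finset (Fin L)} (hA : A ∈ B.Θ) : A.card ≤ B.K :=
  Finset.le_sup (f := Finset.card) hA

theorem gap_le_K (hopt : B.IsUniqueOptimal Astar) (A : Finset (Fin L)) :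
    B.gap Astar A ≤ B.K := by
  have h1 : ret Astar B.meanWeight ≤ Astar.card := by
    simpa [ret] using Finset.sum_le_card_nsmul Astar B.meanWeight 1 fun e _ => (B.meanWeight_mem_Icc e).2
  have h2 : 0 ≤ ret A B.meanWeight := Finset.sum_nonneg fun e _ => (B.meanWeight_mem_Icc e).1
  have h3 : (Astar.card : ℝ) ≤ B.K := by exact_mod_cast card_le_K hopt.1
  unfold gap
  linarith

theorem gap_nonneg (hopt : B.IsUniqueOptimal Astar) {A : Finset (Fin L)} (hA : A ∈ B.Θ) :
    0 ≤ B.gap Astar A := by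
  by_cases h : A = Astar
  · simp [gap, h]
  · exact (sub_pos.2 (hopt.2 A hA h)).le

theorem minGap_le (hopt : B.IsUniqueOptimal Astar) {A : Finset (Fin L)} (hA : A ∈ B.Θ)
    {e : Fin L} (he : e ∉ Astar) (heA : e ∈ A) : B.minGap Astar e ≤ B.gap Astar A :=
  (B.isLeast_minGap Astar hopt e he ⟨A, hA, heA⟩).2
    ⟨A, ⟨hA, heA, sub_pos.2 (hopt.2 A hA fun h => he (h ▸ heA))⟩, rfl⟩

theorem minGap_pos (hopt : B.IsUniqueOptimal Astar) {e : Fin L} (he : e ∉ Astar)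
    (hcover : ∃ A ∈ B.Θ, e ∈ A) : 0 < B.minGap Astar e := by
  obtain ⟨A, hA, h⟩ := (B.isLeast_minGap Astar hopt e he hcover).1
  exact h ▸ hA.2.2

theorem K_pos {e : Fin L} (hcover : ∃ A ∈ B.Θ, e ∈ A) : 0 < B.K := by
  obtain ⟨A, hA, he⟩ := hcover
  exact (Finset.card_pos.2 ⟨e, he⟩).trans_le (card_le_K hA)

theorem radius_le {i n : ℕ} (hi : i < n) (s : ℕ) :
    radius i s ≤ Real.sqrt (1.5 * Real.log n) / Real.sqrt s := by
  have hn : (1 : ℝ) ≤ n := by exact_mod_cast (by omega : 1 ≤ n)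
  have h : Real.log i ≤ Real.log n := by
    rcases Nat.eq_zero_or_pos i with rfl | h0
    · simpa using Real.log_nonneg hn
    · exact Real.log_le_log (by exact_mod_cast h0) (by exact_mod_cast hi.le)
  rw [radius, ← Real.sqrt_div (mul_nonneg (by norm_num) (Real.log_nonneg hn))]
  gcongr

variable {oracle : (Fin L → ℝ) → Finset (Fin L)} (w : ℕ → Fin L → ℝ)

theorem action_mem (horacle : B.IsOracle oracle) (t : ℕ) : action oracle w t ∈ B.Θ := by
  unfold action State.choose
  split_ifs <;> exact horacle.mem _

/-- The chosen set beats `Astar` under the upper confidence bounds. Common items cancel; on `Astar \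
A` the bounds dominate the means, and on `A \ Astar` they exceed them by at most two radii. -/
theorem gap_le_two_mul_sum_radius (horacle : B.IsOracle oracle) (hopt : B.IsUniqueOptimal Astar)
    {i : ℕ} (hmain : ¬ (stateAfter oracle w i).Exploring)
    (hgood : ∀ e, |(stateAfter oracle w i).what e - B.meanWeight e| ≤
      radius i ((stateAfter oracle w i).T e)) :
    B.gap Astar (action oracle w (i + 1)) ≤
      2 * ∑ e ∈ action oracle w (i + 1) \ Astar, radius i ((stateAfter oracle w i).T e) := by
  set A := action oracle w (i + 1) with hA
  set S := stateAfter oracle w i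
  have hle : ret Astar (S.ucb (i + 1)) ≤ ret A (S.ucb (i + 1)) := by
    rw [hA, action_of_not_exploring oracle w hmain]
    exact horacle.le _ _ hopt.1
  have hucb : ∀ e, S.ucb (i + 1) e = S.what e + radius i (S.T e) := fun e => rfl
  have split : ∀ (X Y : Finset (Fin L)) (v : Fin L → ℝ),
      ret X v = ∑ e ∈ X \ Y, v e + ∑ e ∈ X ∩ Y, v e := fun X Y v => by
    rw [ret, add_comm, Finset.sum_inter_add_sum_sdiff]
  rw [split Astar A, split A Astar, Finset.inter_comm A Astar] at hle
  rw [gap, split Astar A, split A Astar, Finset.inter_comm A Astar, Finset.mul_sum]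
  have h1 : ∑ e ∈ Astar \ A, B.meanWeight e ≤ ∑ e ∈ Astar \ A, S.ucb (i + 1) e :=
    Finset.sum_le_sum fun e _ => by
      rw [hucb]; linarith [(abs_le.1 (hgood e)).1]
  have h2 : ∑ e ∈ A \ Astar, S.ucb (i + 1) e ≤
      ∑ e ∈ A \ Astar, (B.meanWeight e + 2 * radius i (S.T e)) :=
    Finset.sum_le_sum fun e _ => by
      rw [hucb]; linarith [(abs_le.1 (hgood e)).2]
  rw [Finset.sum_add_distrib] at h2
  linarith

/-- The reverse amortization of a gap over the items that are responsible for it. -/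
theorem gap_le_sum_max (horacle : B.IsOracle oracle) (hopt : B.IsUniqueOptimal Astar)
    {i n : ℕ} (hi : i < n) (hmain : ¬ (stateAfter oracle w i).Exploring)
    (hgood : ∀ e, |(stateAfter oracle w i).what e - B.meanWeight e| ≤
      radius i ((stateAfter oracle w i).T e)) :
    B.gap Astar (action oracle w (i + 1)) ≤
      ∑ e ∈ action oracle w (i + 1) \ Astar,
        max (4 * Real.sqrt (1.5 * Real.log n) / Real.sqrt ((stateAfter oracle w i).T e) -
          B.minGap Astar e / B.K) 0 := by
  have hA := action_mem w horacle (i + 1)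
  have hgap := gap_le_two_mul_sum_radius w horacle hopt hmain hgood
  set A := action oracle w (i + 1)
  set S := stateAfter oracle w i
  -- The amount that can be subtracted: at most `K` terms, each at most `Δ_A / K`.
  have hd : ∑ e ∈ A \ Astar, B.minGap Astar e / B.K ≤ B.gap Astar A := by
    have h0 := gap_nonneg hopt hA
    rcases (A \ Astar).eq_empty_or_nonempty with h | ⟨e, he⟩
    · simpa [h] using h0
    have hK : (0 : ℝ) < B.K := by
      exact_mod_cast K_pos ⟨A, hA, (Finset.mem_sdiff.1 he).1⟩
    calc ∑ e ∈ A \ Astar, B.minGap Astar e / B.K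
        ≤ (A \ Astar).card • (B.gap Astar A / B.K) :=
          Finset.sum_le_card_nsmul _ _ _ fun e he => by
            have := minGap_le hopt hA (Finset.mem_sdiff.1 he).2 (Finset.mem_sdiff.1 he).1
            gcongr
      _ ≤ B.K * (B.gap Astar A / B.K) := by
          rw [nsmul_eq_mul]
          have : (A \ Astar).card ≤ B.K :=
            (Finset.card_le_card Finset.sdiff_subset).trans (card_le_K hA)
          gcongr
      _ = B.gap Astar A := by field_simp
  have hr : 4 * ∑ e ∈ A \ Astar, radius i (S.T e) ≤
      ∑ e ∈ A \ Astar, 4 * Real.sqrt (1.5 * Real.log n) / Real.sqrt (S.T e) := by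
    rw [Finset.mul_sum]
    refine Finset.sum_le_sum fun e _ => ?_
    have := radius_le hi (S.T e)
    rw [mul_div_assoc]
    linarith
  calc B.gap Astar A ≤ ∑ e ∈ A \ Astar, 4 * Real.sqrt (1.5 * Real.log n) / Real.sqrt (S.T e) -
        ∑ e ∈ A \ Astar, B.minGap Astar e / B.K := by linarith
    _ ≤ _ := by
        rw [← Finset.sum_sub_distrib]
        exact Finset.sum_le_sum fun e _ => le_max_left _ _

open Classical in
theorem gap_le (horacle : B.IsOracle oracle) (hopt : B.IsUniqueOptimal Astar)
    {i n : ℕ} (hi : i < n) :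
    B.gap Astar (action oracle w (i + 1)) ≤
      B.K * (if (stateAfter oracle w i).Exploring then (1 : ℝ) else 0) +
      B.K * ∑ e, (if ¬ (stateAfter oracle w i).Exploring ∧
        radius i ((stateAfter oracle w i).T e) <
          |(stateAfter oracle w i).what e - B.meanWeight e| then (1 : ℝ) else 0) +
      ∑ e ∈ Astarᶜ, (if ¬ (stateAfter oracle w i).Exploring ∧ e ∈ action oracle w (i + 1) then
        max (4 * Real.sqrt (1.5 * Real.log n) / Real.sqrt ((stateAfter oracle w i).T e) -
          B.minGap Astar e / B.K) 0 else 0) := by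
  have hK : (0 : ℝ) ≤ B.K := Nat.cast_nonneg _
  have h2 : ∀ e ∈ Finset.univ, (0 : ℝ) ≤ (if ¬ (stateAfter oracle w i).Exploring ∧
        radius i ((stateAfter oracle w i).T e) <
          |(stateAfter oracle w i).what e - B.meanWeight e| then (1 : ℝ) else 0) :=
    fun e _ => by split_ifs <;> norm_num
  have h3 : 0 ≤ ∑ e ∈ Astarᶜ,
      (if ¬ (stateAfter oracle w i).Exploring ∧ e ∈ action oracle w (i + 1) then
        max (4 * Real.sqrt (1.5 * Real.log n) / Real.sqrt ((stateAfter oracle w i).T e) -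
          B.minGap Astar e / B.K) 0 else 0) :=
    Finset.sum_nonneg fun e _ => by split_ifs <;> simp
  have h2' := mul_nonneg hK (Finset.sum_nonneg h2)
  have hgK := gap_le_K hopt (action oracle w (i + 1))
  by_cases hx : (stateAfter oracle w i).Exploring
  · rw [if_pos hx, mul_one]
    linarith
  rw [if_neg hx, mul_zero, zero_add]
  by_cases hgood : ∀ e, |(stateAfter oracle w i).what e - B.meanWeight e| ≤
      radius i ((stateAfter oracle w i).T e)
  · refine (gap_le_sum_max w horacle hopt hi hx hgood).trans
      (le_trans (le_of_eq ?_) (le_add_of_nonneg_left h2'))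
    rw [← Finset.sum_filter]
    refine Finset.sum_congr ?_ fun _ _ => rfl
    ext e
    simp [hx, and_comm]
  · push Not at hgood
    obtain ⟨e, he⟩ := hgood
    -- One failing item makes the middle sum at least 1, which already pays for the trivial bound
    -- `K` on the gap.
    have h1 := Finset.single_le_sum h2 (Finset.mem_univ e)
    rw [if_pos ⟨hx, he⟩] at h1
    have := le_mul_of_one_le_right hK h1
    linarith

open Classical in
/-- The pathwise bound on the sum of the gaps of the chosen solutions. -/
theorem sum_gap_le (hcover : ∀ e : Fin L, ∃ A ∈ B.Θ, e ∈ A) (horacle : B.IsOracle oracle)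
    (hopt : B.IsUniqueOptimal Astar) (n : ℕ) :
    ∑ i ∈ Finset.range n, B.gap Astar (action oracle w (i + 1)) ≤
      B.K * L +
      B.K * ∑ i ∈ Finset.range n, ∑ e, (if ¬ (stateAfter oracle w i).Exploring ∧
        radius i ((stateAfter oracle w i).T e) <
          |(stateAfter oracle w i).what e - B.meanWeight e| then (1 : ℝ) else 0) +
      ∑ e ∈ Astarᶜ, B.K * (24 / B.minGap Astar e) * Real.log n := by
  refine (Finset.sum_le_sum fun i hi =>
    gap_le w horacle hopt (Finset.mem_range.1 hi)).trans ?_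
  rw [Finset.sum_add_distrib, Finset.sum_add_distrib, ← Finset.mul_sum, ← Finset.mul_sum,
    Finset.sum_comm (t := Astarᶜ)]
  gcongr with e he
  · exact count_exploring_le w B hcover horacle n
  · have hK : (0 : ℝ) < B.K := by exact_mod_cast K_pos (hcover e)
    have hg := minGap_pos hopt (Finset.mem_compl.1 he) (hcover e)
    refine (sum_main_le_potential oracle w (by positivity) (div_pos hg hK) e n).trans
      ((potential_le (div_pos hg hK) _).trans_eq ?_)
    -- The constant 24 is `4 ^ 2 * 1.5`.
    rw [mul_pow, Real.sq_sqrt (mul_nonneg (by norm_num) (Real.log_natCast_nonneg n))]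
    field_simp
    ring

end Gap

/-! ### Measurability of states and actions -/

section Measurability

variable {Ω : Type*} [MeasurableSpace Ω]

/-- All components of a random state are measurable. -/
def MeasurableState (S : Ω → State L) : Prop :=
  (∀ e, Measurable fun ω => (S ω).u e) ∧ (∀ e, Measurable fun ω => (S ω).T e) ∧
    ∀ e, Measurable fun ω => (S ω).what e

theorem MeasurableState.measurableSet_exploring {S : Ω → State L} (hS : MeasurableState S) :
    MeasurableSet {ω | (S ω).Exploring} := by
  simp only [State.Exploring, Set.ofPred_exists]
  exact MeasurableSet.iUnion fun e => hS.1 e (measurableSet_singleton 1)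

theorem MeasurableState.measurableSet_choose {B : CombSemiBandit L}
    {oracle : (Fin L → ℝ) → Finset (Fin L)} (horacle : B.IsOracle oracle)
    {S : Ω → State L} (hS : MeasurableState S) (t : ℕ) (A : Finset (Fin L)) :
    MeasurableSet {ω | (S ω).choose oracle t = A} := by
  have hu : Measurable fun ω => (S ω).u := measurable_pi_iff.2 hS.1
  have hU : Measurable fun ω => (S ω).ucb t := measurable_pi_iff.2 fun e =>
    (hS.2.2 e).add ((measurable_of_countable (radius (t - 1))).comp (hS.2.1 e))
  have := hS.measurableSet_exploring.ite (hu (horacle.meas A)) (hU (horacle.meas A))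
  convert this using 1
  ext ω
  by_cases h : (S ω).Exploring
  · have h' : (S ω).choose oracle t = oracle (S ω).u := if_pos h
    simp [Set.ite, h, h']
  · have h' : (S ω).choose oracle t = oracle ((S ω).ucb t) := if_neg h
    simp [Set.ite, h, h']

theorem measurableSet_mem_of_eq {A : Ω → Finset (Fin L)}
    (hA : ∀ X, MeasurableSet {ω | A ω = X}) (e : Fin L) : MeasurableSet {ω | e ∈ A ω} := by
  have : {ω | e ∈ A ω} = ⋃ X : {X : Finset (Fin L) // e ∈ X}, {ω | A ω = X} := by
    ext ω
    simp
  rw [this]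
  exact MeasurableSet.iUnion fun X => hA X

theorem MeasurableState.update {S : Ω → State L} (hS : MeasurableState S)
    {A : Ω → Finset (Fin L)} (hA : ∀ X, MeasurableSet {ω | A ω = X})
    {v : Ω → Fin L → ℝ} (hv : Measurable v) :
    MeasurableState fun ω => (S ω).update (A ω) (v ω) := by
  classical
  have hx := hS.measurableSet_exploring
  have hm := measurableSet_mem_of_eq hA
  have hve : ∀ e, Measurable fun ω => v ω e := fun e => (measurable_pi_apply e).comp hv
  have hT : ∀ e, Measurable fun ω => ((S ω).T e : ℝ) := fun e =>
    (measurable_of_countable (Nat.cast : ℕ → ℝ)).comp (hS.2.1 e)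
  have hT1 : ∀ e, Measurable fun ω => (((S ω).T e + 1 : ℕ) : ℝ) := fun e =>
    (measurable_of_countable (fun k : ℕ => ((k + 1 : ℕ) : ℝ))).comp (hS.2.1 e)
  refine ⟨fun e => ?_, fun e => ?_, fun e => ?_⟩
  · have : Measurable fun ω =>
        if (S ω).Exploring then (if e ∈ A ω then 0 else (S ω).u e) else (S ω).u e :=
      Measurable.ite hx (Measurable.ite (hm e) measurable_const (hS.1 e)) (hS.1 e)
    refine (congrArg Measurable (funext fun ω => ?_)).mpr this
    by_cases h : (S ω).Exploring
    · dsimp only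
      rw [update_of_exploring h, if_pos h]
    · dsimp only
      rw [update_of_not_exploring h, if_neg h]
  · have : Measurable fun ω =>
        if (S ω).Exploring then (if e ∈ A ω then 1 else (S ω).T e) else
        (if e ∈ A ω then (S ω).T e + 1 else (S ω).T e) :=
      Measurable.ite hx (Measurable.ite (hm e) measurable_const (hS.2.1 e))
        (Measurable.ite (hm e) ((hS.2.1 e).add_const 1) (hS.2.1 e))
    refine (congrArg Measurable (funext fun ω => ?_)).mpr this
    by_cases h : (S ω).Exploring
    · dsimp only
      rw [update_of_exploring h, if_pos h]
    · dsimp only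
      rw [update_of_not_exploring h, if_neg h]
  · have : Measurable fun ω =>
        if (S ω).Exploring then (if e ∈ A ω then v ω e else (S ω).what e) else
        (if e ∈ A ω then ((S ω).T e * (S ω).what e + v ω e) / (((S ω).T e + 1 : ℕ) : ℝ)
          else (S ω).what e) :=
      Measurable.ite hx (Measurable.ite (hm e) (hve e) (hS.2.2 e))
        (Measurable.ite (hm e) ((((hT e).mul (hS.2.2 e)).add (hve e)).div (hT1 e)) (hS.2.2 e))
    refine (congrArg Measurable (funext fun ω => ?_)).mpr this
    by_cases h : (S ω).Exploring
    · dsimp only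
      rw [update_of_exploring h, if_pos h]
    · dsimp only
      rw [update_of_not_exploring h, if_neg h]

variable {B : CombSemiBandit L} {oracle : (Fin L → ℝ) → Finset (Fin L)} {w : ℕ → Ω → Fin L → ℝ}

/-- Only the weights up to time `i` are assumed measurable, so the ambient σ-algebra may be replaced
by stage `i` of the natural filtration. This yields predictability of the next action. -/
theorem measurableState_stateAfter (horacle : B.IsOracle oracle) {i : ℕ}
    (hw : ∀ t ≤ i, Measurable (w t)) :
    MeasurableState fun ω => stateAfter oracle (fun t => w t ω) i := by
  induction i with
  | zero => exact ⟨fun _ => measurable_const, fun _ => measurable_const, fun _ => measurable_const⟩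
  | succ i ih =>
    have hS := ih fun t ht => hw t (by omega)
    exact hS.update (hS.measurableSet_choose horacle (i + 1)) (hw (i + 1) le_rfl)

theorem measurableSet_mem_action (horacle : B.IsOracle oracle) {i : ℕ}
    (hw : ∀ t ≤ i, Measurable (w t)) (e : Fin L) :
    MeasurableSet {ω | e ∈ action oracle (fun t => w t ω) (i + 1)} :=
  measurableSet_mem_of_eq
    ((measurableState_stateAfter horacle hw).measurableSet_choose horacle (i + 1)) e

end Measurability

/-! ### Concentration of the estimates -/

section Concentration

variable {Ω : Type*} [MeasurableSpace Ω] {μ : Measure Ω} {B : CombSemiBandit L}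
  {oracle : (Fin L → ℝ) → Finset (Fin L)} {w : ℕ → Ω → Fin L → ℝ}

theorem ae_mem_cube (hmeas : ∀ t, Measurable (w t)) (hlaw : ∀ t, μ.map (w t) = B.P) (t : ℕ) :
    ∀ᵐ ω ∂μ, ∀ e, w t ω e ∈ Set.Icc (0 : ℝ) 1 :=
  ae_of_ae_map (hmeas t).aemeasurable (by rw [hlaw]; exact B.cube)

theorem integral_weight (hmeas : ∀ t, Measurable (w t)) (hlaw : ∀ t, μ.map (w t) = B.P)
    (t : ℕ) (e : Fin L) : ∫ ω, w t ω e ∂μ = B.meanWeight e := by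
  rw [meanWeight, ← hlaw t, integral_map (hmeas t).aemeasurable
    (measurable_pi_apply e).aestronglyMeasurable]

theorem integrable_weight [IsProbabilityMeasure μ] (hmeas : ∀ t, Measurable (w t))
    (hlaw : ∀ t, μ.map (w t) = B.P) (t : ℕ) (e : Fin L) :
    Integrable (fun ω => w t ω e) μ :=
  Integrable.of_mem_Icc 0 1 ((measurable_pi_apply e).comp (hmeas t)).aemeasurable
    ((ae_mem_cube hmeas hlaw t).mono fun _ h => h e)

/-- Hoeffding's lemma for the weight of one item. -/
theorem lintegral_exp_weight_le [IsProbabilityMeasure μ] (hmeas : ∀ t, Measurable (w t))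
    (hlaw : ∀ t, μ.map (w t) = B.P) (t : ℕ) (e : Fin L) (l : ℝ) :
    ∫⁻ ω, ENNReal.ofReal (Real.exp (l * (w t ω e - B.meanWeight e) - l ^ 2 / 8)) ∂μ ≤ 1 := by
  have hsub := hasSubgaussianMGF_of_mem_Icc (μ := μ) (X := fun ω => w t ω e) (a := 0) (b := 1)
    ((measurable_pi_apply e).comp (hmeas t)).aemeasurable
    ((ae_mem_cube hmeas hlaw t).mono fun _ h => h e)
  rw [integral_weight hmeas hlaw] at hsub
  have hint := hsub.integrable_exp_mul l
  have hle := hsub.mgf_le l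
  have hfun : (fun ω => Real.exp (l * (w t ω e - B.meanWeight e) - l ^ 2 / 8)) =
      fun ω => Real.exp (l * (w t ω e - B.meanWeight e)) * Real.exp (-(l ^ 2 / 8)) := by
    funext ω
    rw [← Real.exp_add, sub_eq_add_neg]
  rw [← ofReal_integral_eq_lintegral_ofReal (by rw [hfun]; exact hint.mul_const _)
    (Filter.Eventually.of_forall fun ω => (Real.exp_pos _).le), ENNReal.ofReal_le_one, hfun,
    integral_mul_const]
  calc (∫ ω, Real.exp (l * (w t ω e - B.meanWeight e)) ∂μ) * Real.exp (-(l ^ 2 / 8))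
      ≤ Real.exp (l ^ 2 / 8) * Real.exp (-(l ^ 2 / 8)) := by
        gcongr
        -- A variable in `[0, 1]` has sub-Gaussian variance proxy `(1/2) ^ 2`, which gives the
        -- exponent `l ^ 2 / 8`.
        refine hle.trans_eq ?_
        congr 1
        simp
        ring
    _ = 1 := by rw [← Real.exp_add]; simp

/-- The exponential process of the observations of item `e`. -/
noncomputable def expState (m : ℝ) (l : ℝ) (e : Fin L) (S : State L) : ENNReal :=
  ENNReal.ofReal (Real.exp (l * (S.T e * (S.what e - m)) - l ^ 2 / 8 * S.T e))

theorem measurable_expState {S : Ω → State L} (hS : MeasurableState S) (m l : ℝ) (e : Fin L) :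
    Measurable fun ω => expState m l e (S ω) := by
  have hT : Measurable fun ω => ((S ω).T e : ℝ) :=
    (measurable_of_countable (Nat.cast : ℕ → ℝ)).comp (hS.2.1 e)
  have hw := hS.2.2 e
  unfold expState
  fun_prop

theorem indep_comap_natural (hmeas : ∀ t, Measurable (w t)) (hindep : iIndepFun w μ) (i : ℕ) :
    Indep (Filtration.natural w (fun t => (hmeas t).stronglyMeasurable) i)
      (MeasurableSpace.comap (w (i + 1)) inferInstance) μ :=
  (hindep.indep_comap_natural_of_lt (fun t => (hmeas t).stronglyMeasurable)
    (Nat.lt_succ_self i)).symm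

theorem measurable_natural (hmeas : ∀ t, Measurable (w t)) {t i : ℕ} (h : t ≤ i) :
    Measurable[Filtration.natural w (fun t => (hmeas t).stronglyMeasurable) i] (w t) :=
  ((Filtration.stronglyAdapted_natural fun t => (hmeas t).stronglyMeasurable) t).measurable.mono
    ((Filtration.natural w fun t => (hmeas t).stronglyMeasurable).mono h) le_rfl

/-- In the main phase an observation multiplies the process by an independent factor of mean at most
1. In the initialization phase it may overwrite an earlier estimate and so reset the process to one
fresh factor; this keeps the mean at most 1 because the choices there are deterministic. -/
theorem lintegral_expState_le [IsProbabilityMeasure μ] (horacle : B.IsOracle oracle)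
    (hmeas : ∀ t, Measurable (w t)) (hlaw : ∀ t, μ.map (w t) = B.P) (hindep : iIndepFun w μ)
    (e : Fin L) (l : ℝ) (i : ℕ) :
    ∫⁻ ω, expState (B.meanWeight e) l e (stateAfter oracle (fun t => w t ω) i) ∂μ ≤ 1 := by
  classical
  set m := B.meanWeight e
  induction i with
  | zero => simp [expState, stateAfter, State.init]
  | succ i ih =>
    set Z : Ω → ENNReal := fun ω =>
      ENNReal.ofReal (Real.exp (l * (w (i + 1) ω e - m) - l ^ 2 / 8)) with hZ
    have hZle : ∫⁻ ω, Z ω ∂μ ≤ 1 := lintegral_exp_weight_le hmeas hlaw (i + 1) e l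
    set S : Ω → State L := fun ω => stateAfter oracle (fun t => w t ω) i with hS
    -- Determinism of `u` makes the phase the same for all `ω`, so the alternative is that no `ω` is
    -- exploring.
    by_cases hx : ∀ ω, (S ω).Exploring
    · by_cases he : ∃ ω, e ∈ action oracle (fun t => w t ω) (i + 1)
      · refine (lintegral_congr fun ω => ?_).trans_le hZle
        obtain ⟨ω', he⟩ := he
        rw [action_of_exploring _ _ (hx ω'), stateAfter_u_eq _ _ (fun t => w t ω),
          ← action_of_exploring _ _ (hx ω)] at he
        rw [stateAfter_succ, update_of_exploring (hx ω)]
        simp [expState, he, hZ]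
      · push Not at he
        refine (lintegral_congr fun ω => ?_).trans_le ih
        rw [stateAfter_succ, update_of_exploring (hx ω)]
        simp [expState, he ω, hS]
    · obtain ⟨ω', hω'⟩ := not_forall.1 hx
      have hx' : ∀ ω, ¬ (S ω).Exploring := fun ω h =>
        hω' ((exploring_iff oracle _ _ i).1 h)
      set F := Filtration.natural w (fun t => (hmeas t).stronglyMeasurable)
      have hwF : ∀ t ≤ i, Measurable[F i] (w t) := fun t ht => measurable_natural hmeas ht
      have hE := @measurableSet_mem_action _ _ (F i) _ _ w horacle i hwF e
      have hM := @measurable_expState _ _ (F i) _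
        (@measurableState_stateAfter _ _ (F i) _ _ w horacle i hwF) m l e
      set E := {ω | e ∈ action oracle (fun t => w t ω) (i + 1)}
      set M : Ω → ENNReal := fun ω => expState m l e (S ω)
      have hFle := F.le i
      -- `T * what` is the running sum of observations, so the update adds `w (i + 1) ω e` to it and
      -- contributes exactly the factor `Z` on `E`.
      have hstep : ∀ ω, expState m l e (stateAfter oracle (fun t => w t ω) (i + 1)) =
          Eᶜ.indicator M ω + E.indicator M ω * Z ω := fun ω => by
        rw [stateAfter_succ, update_of_not_exploring (hx' ω)]
        by_cases he : ω ∈ E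
        · have he' : e ∈ action oracle (fun t => w t ω) (i + 1) := he
          have hT : ((S ω).T e : ℝ) + 1 ≠ 0 := by positivity
          rw [Set.indicator_of_notMem (by simpa using he), Set.indicator_of_mem he, zero_add, hZ]
          simp only [M, expState, he', if_true]
          rw [← ENNReal.ofReal_mul (Real.exp_pos _).le, ← Real.exp_add]
          congr 2
          change l * (((((S ω).T e + 1 : ℕ) : ℝ)) * ((((S ω).T e : ℝ) * (S ω).what e +
            w (i + 1) ω e) / (((S ω).T e + 1 : ℕ) : ℝ) - m)) - l ^ 2 / 8 *
              (((S ω).T e + 1 : ℕ) : ℝ) = _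
          push_cast
          field_simp
          ring
        · have he' : e ∉ action oracle (fun t => w t ω) (i + 1) := he
          rw [Set.indicator_of_mem (by simpa using he), Set.indicator_of_notMem he, zero_mul,
            add_zero]
          simp only [M, expState, he', if_false]
      have hZm : Measurable[MeasurableSpace.comap (w (i + 1)) inferInstance] Z := by
        have : Measurable fun v : Fin L → ℝ =>
            ENNReal.ofReal (Real.exp (l * (v e - m) - l ^ 2 / 8)) := by fun_prop
        exact this.comp (comap_measurable _)
      calc ∫⁻ ω, expState m l e (stateAfter oracle (fun t => w t ω) (i + 1)) ∂μ
          = ∫⁻ ω, Eᶜ.indicator M ω + E.indicator M ω * Z ω ∂μ := lintegral_congr hstep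
        _ = ∫⁻ ω, Eᶜ.indicator M ω ∂μ + ∫⁻ ω, E.indicator M ω * Z ω ∂μ :=
            lintegral_add_left ((hM.indicator hE.compl).mono hFle le_rfl) _
        _ = ∫⁻ ω, Eᶜ.indicator M ω ∂μ + (∫⁻ ω, E.indicator M ω ∂μ) * ∫⁻ ω, Z ω ∂μ := by
            rw [lintegral_mul_eq_lintegral_mul_lintegral_of_independent_measurableSpace hFle
              (hmeas (i + 1)).comap_le (indep_comap_natural hmeas hindep i) (hM.indicator hE) hZm]
        _ ≤ ∫⁻ ω, Eᶜ.indicator M ω ∂μ + (∫⁻ ω, E.indicator M ω ∂μ) * 1 := by gcongr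
        _ = ∫⁻ ω, M ω ∂μ := by
            rw [mul_one, ← lintegral_add_left ((hM.indicator hE.compl).mono hFle le_rfl)]
            exact lintegral_congr fun ω => by
              rw [← Pi.add_apply, Set.indicator_compl_add_self]
        _ ≤ 1 := ih

/-- The deviation in one direction after exactly `s` observations. -/
theorem measureReal_deviation_le [IsProbabilityMeasure μ] (horacle : B.IsOracle oracle)
    (hmeas : ∀ t, Measurable (w t)) (hlaw : ∀ t, μ.map (w t) = B.P) (hindep : iIndepFun w μ)
    (e : Fin L) {i s : ℕ} (hi : 1 ≤ i) (hs : 1 ≤ s) {σ : ℝ} (hσ : σ ^ 2 = 1) :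
    μ.real {ω | (stateAfter oracle (fun t => w t ω) i).T e = s ∧
      radius i s < σ * ((stateAfter oracle (fun t => w t ω) i).what e - B.meanWeight e)} ≤
      1 / (i : ℝ) ^ 3 := by
  have hi0 : (0 : ℝ) < i := by exact_mod_cast hi
  have hs0 : (0 : ℝ) < s := by exact_mod_cast hs
  have hc2 : s * radius i s ^ 2 = 1.5 * Real.log i := by
    rw [radius, Real.sq_sqrt (by have := Real.log_natCast_nonneg i; positivity)]
    field_simp
  have hc0 : 0 ≤ radius i s := Real.sqrt_nonneg _
  set c := radius i s
  -- `l = 4 c σ` optimizes the exponent for a deviation `c`: when `T = s` it is at least `4 s c ^ 2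
  -- - 2 s c ^ 2 = 2 s c ^ 2 = 3 log i`, hence the threshold `i ^ 3` in Markov's inequality.
  have hle := lintegral_expState_le horacle hmeas hlaw hindep e (4 * c * σ) i
  have hM := measurable_expState (measurableState_stateAfter horacle (w := w) (i := i)
    fun t _ => hmeas t) (B.meanWeight e) (4 * c * σ) e
  have hmk := (mul_meas_ge_le_lintegral (μ := μ) hM (ENNReal.ofReal ((i : ℝ) ^ 3))).trans hle
  have hsub : {ω | (stateAfter oracle (fun t => w t ω) i).T e = s ∧
      c < σ * ((stateAfter oracle (fun t => w t ω) i).what e - B.meanWeight e)} ⊆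
      {ω | ENNReal.ofReal ((i : ℝ) ^ 3) ≤ expState (B.meanWeight e) (4 * c * σ) e
        (stateAfter oracle (fun t => w t ω) i)} := by
    rintro ω ⟨hT, hdev⟩
    simp only [Set.mem_ofPred_eq, expState, hT]
    apply ENNReal.ofReal_le_ofReal
    rw [← Real.exp_log (pow_pos hi0 3), Real.log_pow]
    apply Real.exp_le_exp.2
    set x := (stateAfter oracle (fun t => w t ω) i).what e - B.meanWeight e
    have h1 : s * c * c ≤ s * c * (σ * x) := by gcongr
    have h2 : (4 * c * σ) ^ 2 / 8 * s = 2 * (s * c ^ 2) := by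
      rw [mul_pow, hσ]; ring
    rw [h2, hc2]
    push_cast
    nlinarith
  have h3 : (i : ℝ) ^ 3 * μ.real {ω | ENNReal.ofReal ((i : ℝ) ^ 3) ≤
      expState (B.meanWeight e) (4 * c * σ) e (stateAfter oracle (fun t => w t ω) i)} ≤ 1 := by
    have := ENNReal.toReal_mono ENNReal.one_ne_top hmk
    rwa [ENNReal.toReal_mul, ENNReal.toReal_ofReal (by positivity), ENNReal.toReal_one] at this
  rw [le_div_iff₀ (by positivity), mul_comm]
  exact le_trans (mul_le_mul_of_nonneg_left (measureReal_mono hsub) (by positivity)) h3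

/-- The probability that the confidence interval of an item fails after `i` steps. -/
theorem measureReal_bad_le [IsProbabilityMeasure μ] (horacle : B.IsOracle oracle)
    (hmeas : ∀ t, Measurable (w t)) (hlaw : ∀ t, μ.map (w t) = B.P) (hindep : iIndepFun w μ)
    (e : Fin L) (i : ℕ) :
    μ.real {ω | ¬ (stateAfter oracle (fun t => w t ω) i).Exploring ∧
      radius i ((stateAfter oracle (fun t => w t ω) i).T e) <
        |(stateAfter oracle (fun t => w t ω) i).what e - B.meanWeight e|} ≤
      2 * (1 / (i : ℝ) ^ 2) := by
  rcases Nat.eq_zero_or_pos i with rfl | hi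
  -- At `i = 0` the event is empty, matching the right side, which is 0 because `1 / 0 = 0`.
  · have : ∀ ω, (stateAfter oracle (fun t => w t ω) 0).Exploring := fun ω =>
      exploring_zero oracle _ e
    simp [this]
  set D : ℝ → ℕ → Set Ω := fun σ s => {ω | (stateAfter oracle (fun t => w t ω) i).T e = s ∧
      radius i s < σ * ((stateAfter oracle (fun t => w t ω) i).what e - B.meanWeight e)}
  have hsub : {ω | ¬ (stateAfter oracle (fun t => w t ω) i).Exploring ∧
      radius i ((stateAfter oracle (fun t => w t ω) i).T e) <
        |(stateAfter oracle (fun t => w t ω) i).what e - B.meanWeight e|} ⊆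
      ⋃ s ∈ Finset.Icc 1 i, (D 1 s ∪ D (-1) s) := by
    rintro ω ⟨hx, hdev⟩
    -- The counter is random, so the union runs over all its possible values; the `i` of them turn
    -- `i ^ (-3)` into `i ^ (-2)`.
    simp only [Set.mem_iUnion]
    refine ⟨_, Finset.mem_Icc.2 ⟨one_le_T oracle _ hx e, T_le oracle _ i e⟩, ?_⟩
    rcases lt_abs.1 hdev with h | h
    · exact Or.inl ⟨rfl, by rwa [one_mul]⟩
    · exact Or.inr ⟨rfl, by rwa [neg_one_mul]⟩
  have hi0 : (0 : ℝ) < i := by exact_mod_cast hi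
  calc _ ≤ μ.real (⋃ s ∈ Finset.Icc 1 i, (D 1 s ∪ D (-1) s)) :=
        measureReal_mono hsub (measure_ne_top _ _)
    _ ≤ ∑ s ∈ Finset.Icc 1 i, μ.real (D 1 s ∪ D (-1) s) := measureReal_biUnion_finset_le _ _
    _ ≤ ∑ s ∈ Finset.Icc 1 i, (1 / (i : ℝ) ^ 3 + 1 / (i : ℝ) ^ 3) :=
        Finset.sum_le_sum fun s hs => (measureReal_union_le _ _).trans (add_le_add
          (measureReal_deviation_le horacle hmeas hlaw hindep e hi (Finset.mem_Icc.1 hs).1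
            (by norm_num))
          (measureReal_deviation_le horacle hmeas hlaw hindep e hi (Finset.mem_Icc.1 hs).1
            (by norm_num)))
    _ = 2 * (1 / (i : ℝ) ^ 2) := by
        rw [Finset.sum_const, Nat.card_Icc, Nat.add_sub_cancel, nsmul_eq_mul]
        field_simp
        ring

theorem sum_two_mul_one_div_sq_le (n : ℕ) :
    ∑ i ∈ Finset.range n, 2 * (1 / (i : ℝ) ^ 2) ≤ Real.pi ^ 2 / 3 := by
  rw [← Finset.mul_sum]
  have := sum_le_hasSum (Finset.range n) (fun i _ => by positivity) hasSum_zeta_two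
  linarith

end Concentration

/-! ### Expected regret -/

theorem ret_eq_sum_indicator {Ω : Type*} (A : Ω → Finset (Fin L)) (v : Ω → Fin L → ℝ) :
    (fun ω => ret (A ω) (v ω)) =
      fun ω => ∑ e, {ω | e ∈ A ω}.indicator (fun _ => (1 : ℝ)) ω * v ω e := by
  classical
  funext ω
  simp [ret, Set.indicator_apply, Finset.sum_ite_mem]

section Regret

variable {Ω : Type*} [MeasurableSpace Ω] {μ : Measure Ω} [IsProbabilityMeasure μ]
  {B : CombSemiBandit L} {oracle : (Fin L → ℝ) → Finset (Fin L)} {w : ℕ → Ω → Fin L → ℝ}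

theorem integrable_indicator_mul_weight (horacle : B.IsOracle oracle)
    (hmeas : ∀ t, Measurable (w t)) (hlaw : ∀ t, μ.map (w t) = B.P) (i : ℕ) (e : Fin L) :
    Integrable (fun ω => {ω | e ∈ action oracle (fun t => w t ω) (i + 1)}.indicator
      (fun _ => (1 : ℝ)) ω * w (i + 1) ω e) μ := by
  have hE := measurableSet_mem_action horacle (w := w) (i := i) (fun t _ => hmeas t) e
  refine ((integrable_weight hmeas hlaw (i + 1) e).indicator hE).congr
    (Filter.Eventually.of_forall fun ω => ?_)
  by_cases h : e ∈ action oracle (fun t => w t ω) (i + 1) <;> simp [h]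

/-- The event that `e` is chosen at time `i + 1` is determined by the weights up to time `i`, hence
independent of `w (i + 1)`, and the expectation of the product factors. -/
theorem integral_indicator_mul_weight (horacle : B.IsOracle oracle)
    (hmeas : ∀ t, Measurable (w t)) (hlaw : ∀ t, μ.map (w t) = B.P) (hindep : iIndepFun w μ)
    (i : ℕ) (e : Fin L) :
    ∫ ω, {ω | e ∈ action oracle (fun t => w t ω) (i + 1)}.indicator
      (fun _ => (1 : ℝ)) ω * w (i + 1) ω e ∂μ =
    ∫ ω, {ω | e ∈ action oracle (fun t => w t ω) (i + 1)}.indicator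
      (fun _ => (1 : ℝ)) ω * B.meanWeight e ∂μ := by
  have hE := measurableSet_mem_action horacle (w := w) (i := i) (fun t _ => hmeas t) e
  have hEF := @measurableSet_mem_action _ _
    (Filtration.natural w (fun t => (hmeas t).stronglyMeasurable) i) _ _ w horacle i
    (fun t ht => measurable_natural hmeas ht) e
  have hX : Measurable[Filtration.natural w (fun t => (hmeas t).stronglyMeasurable) i]
      ({ω | e ∈ action oracle (fun t => w t ω) (i + 1)}.indicator fun _ => (1 : ℝ)) :=
    measurable_const.indicator hEF
  have hY : Measurable[MeasurableSpace.comap (w (i + 1)) inferInstance]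
      fun ω => w (i + 1) ω e := (measurable_pi_apply e).comp (comap_measurable _)
  have hind : IndepFun ({ω | e ∈ action oracle (fun t => w t ω) (i + 1)}.indicator
      (fun _ => (1 : ℝ))) (fun ω => w (i + 1) ω e) μ :=
    (IndepFun_iff_Indep _ _ _).2
      (indep_of_indep_of_le (indep_comap_natural hmeas hindep i) hX.comap_le hY.comap_le)
  rw [hind.integral_fun_mul_eq_mul_integral
    (measurable_const.indicator hE).aestronglyMeasurable
    (integrable_weight hmeas hlaw (i + 1) e).aestronglyMeasurable,
    integral_weight hmeas hlaw, integral_mul_const]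

theorem integrable_ret_action (horacle : B.IsOracle oracle)
    (hmeas : ∀ t, Measurable (w t)) (hlaw : ∀ t, μ.map (w t) = B.P) (i : ℕ) :
    Integrable (fun ω => ret (action oracle (fun t => w t ω) (i + 1)) (w (i + 1) ω)) μ := by
  rw [ret_eq_sum_indicator]
  exact integrable_finsetSum _ fun e _ => integrable_indicator_mul_weight horacle hmeas hlaw i e

theorem integrable_ret_meanWeight_action (horacle : B.IsOracle oracle)
    (hmeas : ∀ t, Measurable (w t)) (i : ℕ) :
    Integrable (fun ω => ret (action oracle (fun t => w t ω) (i + 1)) B.meanWeight) μ := by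
  rw [ret_eq_sum_indicator _ (fun _ => B.meanWeight)]
  exact integrable_finsetSum _ fun e _ => ((integrable_const 1).indicator
    (measurableSet_mem_action horacle (fun t _ => hmeas t) e)).mul_const _

theorem integral_ret_action (horacle : B.IsOracle oracle)
    (hmeas : ∀ t, Measurable (w t)) (hlaw : ∀ t, μ.map (w t) = B.P) (hindep : iIndepFun w μ)
    (i : ℕ) :
    ∫ ω, ret (action oracle (fun t => w t ω) (i + 1)) (w (i + 1) ω) ∂μ =
      ∫ ω, ret (action oracle (fun t => w t ω) (i + 1)) B.meanWeight ∂μ := by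
  rw [ret_eq_sum_indicator, ret_eq_sum_indicator _ (fun _ => B.meanWeight),
    integral_finsetSum _ fun e _ => integrable_indicator_mul_weight horacle hmeas hlaw i e,
    integral_finsetSum _ fun e _ => ((integrable_const 1).indicator
      (measurableSet_mem_action horacle (fun t _ => hmeas t) e)).mul_const _]
  exact Finset.sum_congr rfl fun e _ =>
    integral_indicator_mul_weight horacle hmeas hlaw hindep i e

variable {Astar : Finset (Fin L)}

theorem integrable_ret (hmeas : ∀ t, Measurable (w t)) (hlaw : ∀ t, μ.map (w t) = B.P)
    (A : Finset (Fin L)) (t : ℕ) : Integrable (fun ω => ret A (w t ω)) μ :=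
  integrable_finsetSum _ fun e _ => integrable_weight hmeas hlaw t e

theorem integral_ret (hmeas : ∀ t, Measurable (w t)) (hlaw : ∀ t, μ.map (w t) = B.P)
    (A : Finset (Fin L)) (t : ℕ) : ∫ ω, ret A (w t ω) ∂μ = ret A B.meanWeight := by
  unfold ret
  rw [integral_finsetSum _ fun e _ => integrable_weight hmeas hlaw t e]
  exact Finset.sum_congr rfl fun e _ => integral_weight hmeas hlaw t e

theorem cumRegret_eq_sum_range (v : ℕ → Fin L → ℝ) (n : ℕ) :
    cumRegret Astar oracle v n =
      ∑ i ∈ Finset.range n, (ret Astar (v (i + 1)) - ret (action oracle v (i + 1)) (v (i + 1))) := by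
  rw [cumRegret, Finset.range_eq_Ico,
    Finset.sum_Ico_add' (fun t => ret Astar (v t) - ret (action oracle v t) (v t)) 0 n 1]
  rfl

theorem integrable_cumRegret (horacle : B.IsOracle oracle)
    (hmeas : ∀ t, Measurable (w t)) (hlaw : ∀ t, μ.map (w t) = B.P) (n : ℕ) :
    Integrable (fun ω => cumRegret Astar oracle (fun t => w t ω) n) μ := by
  simp_rw [cumRegret_eq_sum_range]
  exact integrable_finsetSum _ fun i _ => (integrable_ret hmeas hlaw Astar (i + 1)).sub
    (integrable_ret_action horacle hmeas hlaw i)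

theorem integrable_gap_action (horacle : B.IsOracle oracle)
    (hmeas : ∀ t, Measurable (w t)) (i : ℕ) :
    Integrable (fun ω => B.gap Astar (action oracle (fun t => w t ω) (i + 1))) μ :=
  (integrable_const _).sub (integrable_ret_meanWeight_action horacle hmeas i)

/-- The expected regret is the expected sum of the gaps of the chosen solutions. -/
theorem integral_cumRegret (horacle : B.IsOracle oracle)
    (hmeas : ∀ t, Measurable (w t)) (hlaw : ∀ t, μ.map (w t) = B.P) (hindep : iIndepFun w μ)
    (n : ℕ) :
    ∫ ω, cumRegret Astar oracle (fun t => w t ω) n ∂μ =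
      ∫ ω, ∑ i ∈ Finset.range n, B.gap Astar (action oracle (fun t => w t ω) (i + 1)) ∂μ := by
  simp_rw [cumRegret_eq_sum_range]
  have hint : ∀ i, Integrable (fun ω => ret Astar (w (i + 1) ω) -
      ret (action oracle (fun t => w t ω) (i + 1)) (w (i + 1) ω)) μ := fun i =>
    (integrable_ret hmeas hlaw Astar (i + 1)).sub (integrable_ret_action horacle hmeas hlaw i)
  rw [integral_finsetSum _ fun i _ => hint i,
    integral_finsetSum _ fun i _ => integrable_gap_action horacle hmeas i]
  refine Finset.sum_congr rfl fun i _ => ?_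
  unfold gap
  rw [integral_sub (integrable_ret hmeas hlaw Astar (i + 1))
    (integrable_ret_action horacle hmeas hlaw i), integral_ret hmeas hlaw,
    integral_ret_action horacle hmeas hlaw hindep,
    integral_sub (integrable_const _) (integrable_ret_meanWeight_action horacle hmeas i)]
  simp

theorem measurableSet_bad (horacle : B.IsOracle oracle) (hmeas : ∀ t, Measurable (w t))
    (e : Fin L) (i : ℕ) :
    MeasurableSet {ω | ¬ (stateAfter oracle (fun t => w t ω) i).Exploring ∧
      radius i ((stateAfter oracle (fun t => w t ω) i).T e) <
        |(stateAfter oracle (fun t => w t ω) i).what e - B.meanWeight e|} := by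
  have hS := measurableState_stateAfter horacle (w := w) (i := i) fun t _ => hmeas t
  exact hS.measurableSet_exploring.compl.inter (measurableSet_lt
    ((measurable_of_countable (radius i)).comp (hS.2.1 e)) (((hS.2.2 e).sub_const _).abs))

/-- The regret bound of the analysis, with the linear dependence on `K`. -/
theorem integral_cumRegret_le (hcover : ∀ e : Fin L, ∃ A ∈ B.Θ, e ∈ A)
    (hopt : B.IsUniqueOptimal Astar) (horacle : B.IsOracle oracle)
    (hmeas : ∀ t, Measurable (w t)) (hlaw : ∀ t, μ.map (w t) = B.P) (hindep : iIndepFun w μ)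
    (n : ℕ) :
    ∫ ω, cumRegret Astar oracle (fun t => w t ω) n ∂μ ≤
      ∑ e ∈ Astarᶜ, (B.K : ℝ) * (24 / B.minGap Astar e) * Real.log n +
        (Real.pi ^ 2 / 3 + 1) * B.K * L := by
  classical
  set D : ℕ → Fin L → Set Ω := fun i e =>
    {ω | ¬ (stateAfter oracle (fun t => w t ω) i).Exploring ∧
      radius i ((stateAfter oracle (fun t => w t ω) i).T e) <
        |(stateAfter oracle (fun t => w t ω) i).what e - B.meanWeight e|} with hD
  have hDint : ∀ i e, Integrable ((D i e).indicator fun _ => (1 : ℝ)) μ := fun i e =>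
    (integrable_const 1).indicator (measurableSet_bad horacle hmeas e i)
  have hDI : ∀ i, ∫ ω, ∑ e, (D i e).indicator (fun _ => (1 : ℝ)) ω ∂μ =
      ∑ e, μ.real (D i e) := fun i => by
    rw [integral_finsetSum _ fun e _ => hDint i e]
    refine Finset.sum_congr rfl fun e _ => ?_
    rw [integral_indicator_const (1 : ℝ) (measurableSet_bad horacle hmeas e i), smul_eq_mul,
      mul_one]
  have hDsum : Integrable (fun ω => ∑ i ∈ Finset.range n, ∑ e,
      (D i e).indicator (fun _ => (1 : ℝ)) ω) μ :=
    integrable_finsetSum _ fun i _ => integrable_finsetSum _ fun e _ => hDint i e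
  have hDadd : Integrable (fun ω => (B.K * L : ℝ) + B.K * ∑ i ∈ Finset.range n, ∑ e,
      (D i e).indicator (fun _ => (1 : ℝ)) ω) μ :=
    (integrable_const _).add (hDsum.const_mul _)
  set R := ∑ e ∈ Astarᶜ, (B.K : ℝ) * (24 / B.minGap Astar e) * Real.log n
  rw [integral_cumRegret horacle hmeas hlaw hindep]
  calc ∫ ω, ∑ i ∈ Finset.range n, B.gap Astar (action oracle (fun t => w t ω) (i + 1)) ∂μ
      ≤ ∫ ω, (B.K * L + B.K * ∑ i ∈ Finset.range n, ∑ e,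
          (D i e).indicator (fun _ => (1 : ℝ)) ω + R) ∂μ := by
        refine integral_mono
          (integrable_finsetSum _ fun i _ => integrable_gap_action horacle hmeas i)
          (hDadd.add (integrable_const _)) fun ω => ?_
        refine (sum_gap_le (fun t => w t ω) hcover horacle hopt n).trans_eq ?_
        simp only [hD, Set.indicator_apply, Set.mem_ofPred_eq]
        rfl
    _ = B.K * L + B.K * ∑ i ∈ Finset.range n, ∑ e, μ.real (D i e) + R := by
        rw [integral_add hDadd (integrable_const _),
          integral_add (integrable_const _) (hDsum.const_mul _), integral_const, integral_const_mul,
          integral_finsetSum _ fun i _ => integrable_finsetSum _ fun e _ => hDint i e]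
        simp [hDI]
    _ ≤ B.K * L + B.K * (L * (Real.pi ^ 2 / 3)) + R := by
        gcongr
        calc ∑ i ∈ Finset.range n, ∑ e, μ.real (D i e)
            ≤ ∑ i ∈ Finset.range n, ∑ e : Fin L, 2 * (1 / (i : ℝ) ^ 2) :=
              Finset.sum_le_sum fun i _ => Finset.sum_le_sum fun e _ =>
                measureReal_bad_le horacle hmeas hlaw hindep e i
          _ = L * ∑ i ∈ Finset.range n, 2 * (1 / (i : ℝ) ^ 2) := by
              rw [Finset.mul_sum]
              simp
          _ ≤ L * (Real.pi ^ 2 / 3) := by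
              gcongr
              exact sum_two_mul_one_div_sq_le n
    _ = _ := by ring

end Regret

end CombSemiBandit

theorem mainTheorem6 {L : ℕ} (B : CombSemiBandit L)
    (hcover : ∀ e : Fin L, ∃ A ∈ B.Θ, e ∈ A)
    (Astar : Finset (Fin L)) (hopt : B.IsUniqueOptimal Astar)
    (oracle : (Fin L → ℝ) → Finset (Fin L)) (horacle : B.IsOracle oracle)
    {Ω : Type*} [MeasurableSpace Ω] (μ : Measure Ω) [IsProbabilityMeasure μ]
    (w : ℕ → Ω → Fin L → ℝ) (hmeas : ∀ t, Measurable (w t))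
    (hlaw : ∀ t, μ.map (w t) = B.P) (hindep : iIndepFun w μ) (n : ℕ) :
    Integrable (fun ω => CombSemiBandit.cumRegret Astar oracle (fun t => w t ω) n) μ ∧
      ∫ ω, CombSemiBandit.cumRegret Astar oracle (fun t => w t ω) n ∂μ ≤
        ∑ e ∈ Astarᶜ, (B.K : ℝ) ^ (4 / 3 : ℝ) * (96 / B.minGap Astar e) * Real.log n +
          (Real.pi ^ 2 / 3 + 1) * B.K * L := by
  refine ⟨CombSemiBandit.integrable_cumRegret horacle hmeas hlaw n,
    (CombSemiBandit.integral_cumRegret_le hcover hopt horacle hmeas hlaw hindep n).trans ?_⟩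
  gcongr with e he
  · have hg := CombSemiBandit.minGap_pos hopt (Finset.mem_compl.1 he) (hcover e)
    positivity
  -- Raising the exponent from 1 to `4/3` needs `K ≥ 1`, which holds because the item `e` lies in a
  -- feasible set.
  · have hK : (1 : ℝ) ≤ B.K := by exact_mod_cast CombSemiBandit.K_pos (hcover e)
    calc (B.K : ℝ) = (B.K : ℝ) ^ (1 : ℝ) := (Real.rpow_one _).symm
      _ ≤ (B.K : ℝ) ^ (4 / 3 : ℝ) := Real.rpow_le_rpow_of_exponent_le hK (by norm_num)
  · exact (CombSemiBandit.minGap_pos hopt (Finset.mem_compl.1 he) (hcover e)).le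
  · norm_num
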